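/- In the Euclidean plane let $\mathcal C$ be a circle and let $\mathcal I$ be a circle (of positive radius) whose centre $D$ does not lie on $\mathcal C$. Poles and polars are taken with respect to $\mathcal I$. Consider triangles $ABC$ inscribed in $\mathcal C$ such that $D$ lies on none of the side lines (a "side" is the full line through two vertices). Let $A_p,B_p,C_p$ be the poles of the sides $BC,CA,AB$; the triangle $A_pB_pC_p$ is the polar triangle of $ABC$. A conic is a nondegenerate real conic (ellipse, circle, parabola or hyperbola), and tangency is understood in the projective plane, so that the asymptotes of a hyperbola count as tangents (the centre of a circle counts as its focus). (i) For every family of such triangles the following are equivalent: (a) there is a fixed circle $\mathcal C_p$ on which the poles of the sides of all triangles of the family lie; (b) there is one fixed conic $\gamma_D$ with focus $D$ to which the sides of all triangles of the family are tangent. More precisely, for each circle $\mathcal C_p$ there is a conic $\gamma_D$ with focus $D$, and for each conic $\gamma_D$ with focus $D$ there is a circle $\mathcal C_p$, such that for every such triangle the poles of its sides lie on $\mathcal C_p$ if and only if its sides are tangent to $\gamma_D$. (ii) There is a fixed conic $\Gamma_p$ with focus $D$ (depending only on $\mathcal C$ and $\mathcal I$) such that, for every family as in (i) which satisfies the equivalent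 conditions (a), (b), the sides of the polar triangles of all triangles of the family are tangent to $\Gamma_p$. -/

import Mathlib

open EuclideanGeometry Matrix

/-- The Euclidean plane. -/
abbrev Plane : Type := EuclideanSpace ℝ (Fin 2)

/-- The polar of a point `P` with respect to the circle `I` with centre `D` and radius `r`:
the line `{X | ⟨X - D, P - D⟩ = r ^ 2}` (a line exactly when `P ≠ D`). -/
def polar (I : Sphere Plane) (P : Plane) : AffineSubspace ℝ Plane where
  carrier := {X | inner ℝ (X - I.center) (P - I.center) = I.radius ^ 2}
  smul_vsub_vadd_mem' := by
    intro c X Y Z hX hY hZ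
    simp only [Set.mem_ofPred_eq, vsub_eq_sub, vadd_eq_add] at *
    have h : c • (X - Y) + Z - I.center
        = c • ((X - I.center) - (Y - I.center)) + (Z - I.center) := by
      simp only [sub_sub_sub_cancel_right]; abel
    rw [h, inner_add_left, inner_smul_left, inner_sub_left, hX, hY, hZ]
    simp

open Classical in
/-- The pole of a line `L` with respect to the circle `I`: the point whose polar is `L`.
(It exists and is unique for every line that misses the centre of `I`, see `polar_pole` and
`pole_polar`; the value for other `L` is irrelevant.) -/
noncomputable def pole (I : Sphere Plane) (L : AffineSubspace ℝ Plane) : Plane :=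
  if h : ∃ P, polar I P = L then h.choose else I.center

/-- The `i`-th side of the triangle with vertices `p 0, p 1, p 2`: the whole line through the two
vertices other than `p i` (indices modulo `3`). -/
noncomputable def sideLine (p : Fin 3 → Plane) (i : Fin 3) : AffineSubspace ℝ Plane :=
  affineSpan ℝ {p (i + 1), p (i + 2)}

/-- The vertices of the polar triangle: the `i`-th one is the pole of the `i`-th side. -/
noncomputable def polarTriangle (I : Sphere Plane) (p : Fin 3 → Plane) : Fin 3 → Plane :=
  fun i => pole I (sideLine p i)

/-- The triangle `T` is inscribed in the circle `C`, and the point `D` lies on none of its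
side lines. -/
def InscribedAvoiding (C : Sphere Plane) (D : Plane) (T : Affine.Triangle ℝ Plane) : Prop :=
  (∀ i, T.points i ∈ C) ∧ ∀ i, D ∉ sideLine T.points i

/-- Homogeneous coordinates of a point of the affine plane. -/
def homog (X : Plane) : Fin 3 → ℝ := ![X 0, X 1, 1]

/-- The linear subspace of `ℝ³` that represents the projective closure of a line of the plane. -/
def projClosure (L : AffineSubspace ℝ Plane) : Submodule ℝ (Fin 3 → ℝ) :=
  Submodule.span ℝ (homog '' (L : Set Plane))

/-- A nondegenerate real conic, given by a nonsingular symmetric matrix whose quadratic form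
`v ↦ vᵀ M v` has a nontrivial real zero. Its points are the points `[v]` of the real projective
plane with `vᵀ M v = 0`; in the affine plane it is an ellipse (possibly a circle), a parabola or a
hyperbola. -/
structure Conic where
  M : Matrix (Fin 3) (Fin 3) ℝ
  symm : M.IsSymm
  nondegenerate : M.det ≠ 0
  real_point : ∃ v : Fin 3 → ℝ, v ≠ 0 ∧ v ⬝ᵥ (M *ᵥ v) = 0

/-- The line `L` is tangent to the conic `γ`: for some point `[v]` of `γ`, it is the tangent
`{w | vᵀ M w = 0}` of `γ` at `[v]`. The point of contact may be at infinity, so the asymptotes of a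
hyperbola are tangents of it. -/
def Conic.IsTangent (γ : Conic) (L : AffineSubspace ℝ Plane) : Prop :=
  ∃ v : Fin 3 → ℝ, v ≠ 0 ∧ v ⬝ᵥ (γ.M *ᵥ v) = 0 ∧
    ∀ w, w ∈ projClosure L ↔ v ⬝ᵥ (γ.M *ᵥ w) = 0

/-- `D` is a focus of `γ` (focus-directrix property): up to a factor, the equation of `γ` is
`|X - D|² = f(X)²` with an affine function `f(X) = a X₀ + b X₁ + k`. If `(a, b) ≠ 0`, then the line
`f = 0` is the directrix, `e = |(a, b)|` the eccentricity and `|f(X)|` is `e` times the distance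
from `X` to the directrix; if `(a, b) = 0`, then `γ` is a circle with centre `D`. -/
def Conic.IsFocus (γ : Conic) (D : Plane) : Prop :=
  ∃ c a b k : ℝ, c ≠ 0 ∧ ∀ X : Plane,
    homog X ⬝ᵥ (γ.M *ᵥ homog X) = c * (dist X D ^ 2 - (a * X 0 + b * X 1 + k) ^ 2)

theorem mem_polar_iff (I : Sphere Plane) (P X : Plane) :
    X ∈ polar I P ↔ (X 0 - I.center 0) * (P 0 - I.center 0)
      + (X 1 - I.center 1) * (P 1 - I.center 1) = I.radius ^ 2 := by
  change inner ℝ (X - I.center) (P - I.center) = I.radius ^ 2 ↔ _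
  simp [PiLp.inner_apply, Fin.sum_univ_two, mul_comm]

/-- Every line that misses the centre of `I` is the polar of its pole. -/
theorem polar_pole (I : Sphere Plane) (hI : 0 < I.radius) (A B : Plane) (hAB : A ≠ B)
    (hD : I.center ∉ affineSpan ℝ {A, B}) :
    polar I (pole I (affineSpan ℝ {A, B})) = affineSpan ℝ {A, B} := by
  have hex : ∃ P, polar I P = affineSpan ℝ {A, B} := by
    obtain ⟨D, r⟩ := I
    simp only at hI hD
    set u := B 0 - A 0 with hu
    set v := B 1 - A 1 with hv
    have huv : u ^ 2 + v ^ 2 ≠ 0 := by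
      intro h
      apply hAB
      have h0 : u = 0 := by nlinarith [sq_nonneg u, sq_nonneg v]
      have h1 : v = 0 := by nlinarith [sq_nonneg u, sq_nonneg v]
      ext i
      fin_cases i
      · change A 0 = B 0; linarith
      · change A 1 = B 1; linarith
    have key : ∀ X : Plane, X ∈ affineSpan ℝ {A, B} ↔ -v * (X 0 - A 0) + u * (X 1 - A 1) = 0 := by
      intro X
      rw [mem_affineSpan_pair_iff_exists_lineMap_eq]
      constructor
      · rintro ⟨t, rfl⟩
        simp [AffineMap.lineMap_apply, hu, hv]
        ring
      · intro h
        refine ⟨(u * (X 0 - A 0) + v * (X 1 - A 1)) / (u ^ 2 + v ^ 2), ?_⟩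
        ext i
        fin_cases i
        · simp [AffineMap.lineMap_apply, ← hu]
          field_simp
          linear_combination v * h
        · simp [AffineMap.lineMap_apply, ← hv]
          field_simp
          linear_combination -u * h
    rw [key] at hD
    set c := -v * (D 0 - A 0) + u * (D 1 - A 1) with hc
    refine ⟨!₂[D 0 + r ^ 2 / c * v, D 1 - r ^ 2 / c * u], ?_⟩
    ext X
    rw [mem_polar_iff, key]
    simp
    have hr : r ^ 2 ≠ 0 := by positivity
    constructor
    · intro h
      field_simp at h
      linear_combination (-1 : ℝ) * h - hc
    · intro h
      field_simp
      linear_combination (-1 : ℝ) * h - hc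
  rw [pole, dif_pos hex]
  exact hex.choose_spec

/-- Every point other than the centre of `I` is the pole of its polar. -/
theorem pole_polar (I : Sphere Plane) (hI : 0 < I.radius) (P : Plane) (hP : P ≠ I.center) :
    pole I (polar I P) = P := by
  have hex : ∃ Q, polar I Q = polar I P := ⟨P, rfl⟩
  rw [pole, dif_pos hex]
  have h := hex.choose_spec
  generalize hex.choose = Q at h
  obtain ⟨D, r⟩ := I
  simp only at hI hP
  have hr : r ^ 2 ≠ 0 := by positivity
  set a := P 0 - D 0 with ha
  set b := P 1 - D 1 with hb
  have hab : a ^ 2 + b ^ 2 ≠ 0 := by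
    intro h
    apply hP
    have h0 : a = 0 := by nlinarith [sq_nonneg a, sq_nonneg b]
    have h1 : b = 0 := by nlinarith [sq_nonneg a, sq_nonneg b]
    ext i
    fin_cases i
    · change P 0 = D 0; linarith
    · change P 1 = D 1; linarith
  have hmem : ∀ t : ℝ, (r ^ 2 / (a ^ 2 + b ^ 2) * a - t * b) * (Q 0 - D 0)
      + (r ^ 2 / (a ^ 2 + b ^ 2) * b + t * a) * (Q 1 - D 1) = r ^ 2 := by
    intro t
    have hX : (!₂[D 0 + (r ^ 2 / (a ^ 2 + b ^ 2) * a - t * b),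
        D 1 + (r ^ 2 / (a ^ 2 + b ^ 2) * b + t * a)] : Plane) ∈ polar ⟨D, r⟩ P := by
      rw [mem_polar_iff]
      simp [← ha, ← hb]
      field_simp
      ring
    rw [← h, mem_polar_iff] at hX
    simpa using hX
  have e0 := hmem 0
  have e1 := hmem 1
  have f1 : -b * (Q 0 - D 0) + a * (Q 1 - D 1) = 0 := by linear_combination e1 - e0
  have f0 : a * (Q 0 - D 0) + b * (Q 1 - D 1) = a ^ 2 + b ^ 2 := by
    field_simp at e0
    simp only [mul_zero, sub_zero, add_zero] at e0
    apply mul_left_cancel₀ hr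
    linear_combination e0
  ext i
  fin_cases i
  · change Q 0 = P 0
    apply mul_left_cancel₀ hab
    linear_combination a * f0 - b * f1 + (a ^ 2 + b ^ 2) * ha
  · change Q 1 = P 1
    apply mul_left_cancel₀ hab
    linear_combination b * f0 + a * f1 + (a ^ 2 + b ^ 2) * hb

/-!
A conic `γ` with focus `D` has an equation `‖X - D‖² = (⟪n, X - D⟫ + κ)²` with `κ ≠ 0`. In the
homogeneous coordinates `q = X - D`, `s = ⟪n, X - D⟫ + κ` it becomes the cone `‖q‖² = s²`.
A line is tangent to a conic exactly when its pole with respect to that conic lies on it, and the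
pole of the line `⟪m, X - D⟫ + μ = 0` with respect to `γ` has coordinates
`(q, s) = (κ • m - μ • n, -μ)`. The line is therefore tangent iff `‖κ • m - μ • n‖ = |μ|`. For the
polar of `P`, where `m = P - D` and `μ = -r²`, this says that `P` lies on the circle with centre
`D - (r² / κ) • n` and radius `r² / |κ|`, and every circle arises in this way.

So reciprocation in a circle centred at `D` exchanges circles and conics with focus `D`. Applied to
the poles of the sides this is (i). Applied to the vertices it is (ii): the sides of the polar
triangle are the polars of the vertices, which lie on the circumscribed circle.
-/

open scoped RealInnerProductSpace

theorem affineSpan_pair_eq_of_ne_top {k V P : Type*} [DivisionRing k] [AddCommGroup V] [Module k V]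
    [AddTorsor V P] (hV : Module.finrank k V = 2) {L : AffineSubspace k P} (hL : L ≠ ⊤) {A B : P}
    (hAB : A ≠ B) (hA : A ∈ L) (hB : B ∈ L) : affineSpan k {A, B} = L := by
  have : FiniteDimensional k V := Module.finite_of_finrank_eq_succ hV
  refine le_antisymm (affineSpan_pair_le_of_mem_of_mem hA hB) fun X hX => ?_
  by_contra hXAB
  have hABX : AffineIndependent k ![A, B, X] :=
    affineIndependent_of_ne_of_mem_of_mem_of_notMem hAB (left_mem_affineSpan_pair k A B)
      (right_mem_affineSpan_pair k A B) hXAB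
  have hspan : affineSpan k (Set.range ![A, B, X]) = ⊤ := by
    rw [hABX.affineSpan_eq_top_iff_card_eq_finrank_add_one, hV, Fintype.card_fin]
  refine hL (top_le_iff.1 (hspan ▸ affineSpan_le.2 ?_))
  rintro _ ⟨j, rfl⟩
  fin_cases j
  exacts [hA, hB, hX]

section Polar

variable {I : Sphere Plane} {P Q : Plane}

theorem mem_polar_comm : P ∈ polar I Q ↔ Q ∈ polar I P := by
  simp only [mem_polar_iff, mul_comm]

theorem center_notMem_polar (hI : I.radius ≠ 0) : I.center ∉ polar I P := by
  rw [mem_polar_iff, sub_self, sub_self, zero_mul, zero_mul, add_zero]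
  exact (pow_ne_zero 2 hI).symm

theorem ne_center_of_mem_polar (hI : I.radius ≠ 0) (h : Q ∈ polar I P) : P ≠ I.center := by
  rintro rfl
  exact center_notMem_polar hI (mem_polar_comm.1 h)

theorem affineSpan_pair_eq_polar (hI : I.radius ≠ 0) {A B : Plane} (hAB : A ≠ B)
    (hA : A ∈ polar I P) (hB : B ∈ polar I P) : affineSpan ℝ {A, B} = polar I P :=
  affineSpan_pair_eq_of_ne_top finrank_euclideanSpace_fin
    (fun h => center_notMem_polar hI (h ▸ AffineSubspace.mem_top ℝ Plane I.center)) hAB hA hB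

end Polar

section Triangle

variable {I : Sphere Plane} {T : Affine.Triangle ℝ Plane}

theorem points_mem_sideLine_iff {i j : Fin 3} : T.points j ∈ sideLine T.points i ↔ j ≠ i := by
  rw [sideLine, ← Set.image_pair, T.independent.mem_affineSpan_iff, Set.mem_insert_iff,
    Set.mem_singleton_iff]
  decide +revert

theorem sideLine_injective : Function.Injective (sideLine T.points) := by
  intro i j h
  by_contra hij
  exact points_mem_sideLine_iff.1 (h ▸ points_mem_sideLine_iff.2 hij : T.points i ∈ _) rfl

theorem polar_polarTriangle (hI : 0 < I.radius) {i : Fin 3}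
    (hT : I.center ∉ sideLine T.points i) :
    polar I (polarTriangle I T.points i) = sideLine T.points i :=
  polar_pole I hI _ _
    (T.independent.injective.ne ((add_right_injective i).ne (by decide))) hT

theorem polarTriangle_ne_center (hI : 0 < I.radius) {i : Fin 3}
    (hT : I.center ∉ sideLine T.points i) : polarTriangle I T.points i ≠ I.center := by
  have hvertex : T.points (i + 1) ∈ sideLine T.points i :=
    points_mem_sideLine_iff.2 (add_ne_left.2 (by decide))
  rw [← polar_polarTriangle hI hT] at hvertex
  exact ne_center_of_mem_polar hI.ne' hvertex

theorem sideLine_polarTriangle (hI : 0 < I.radius) (hT : ∀ i, I.center ∉ sideLine T.points i)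
    (i : Fin 3) : sideLine (polarTriangle I T.points) i = polar I (T.points i) := by
  have hmem : ∀ j ≠ i, polarTriangle I T.points j ∈ polar I (T.points i) := by
    intro j hj
    rw [mem_polar_comm, polar_polarTriangle hI (hT j)]
    exact points_mem_sideLine_iff.2 hj.symm
  refine affineSpan_pair_eq_polar hI.ne' (fun h => ?_)
    (hmem _ (add_ne_left.2 (by decide))) (hmem _ (add_ne_left.2 (by decide)))
  have hsides := congrArg (polar I) h
  rw [polar_polarTriangle hI (hT _), polar_polarTriangle hI (hT _)] at hsides
  exact (add_right_injective i).ne (by decide) (sideLine_injective hsides)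

end Triangle

theorem inner_plane (X Y : Plane) : ⟪X, Y⟫ = X 0 * Y 0 + X 1 * Y 1 := by
  simp [PiLp.inner_apply, Fin.sum_univ_two, mul_comm]

section LineForm

/-- The linear map on homogeneous coordinates that extends the displacement `X ↦ X - D`. -/
noncomputable def displacement (D : Plane) : (Fin 3 → ℝ) →ₗ[ℝ] Plane where
  toFun w := !₂[w 0, w 1] - w 2 • D
  map_add' v w := by ext i; fin_cases i <;> simp <;> ring
  map_smul' t w := by ext i; fin_cases i <;> simp <;> ring

/-- The linear form on homogeneous coordinates whose zeros are the points of the line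
`⟪n, X - D⟫ + κ = 0`. -/
noncomputable def lineForm (D n : Plane) (κ : ℝ) : (Fin 3 → ℝ) →ₗ[ℝ] ℝ :=
  innerₗ Plane n ∘ₗ displacement D + κ • LinearMap.proj 2

variable {D n : Plane} {κ : ℝ}

theorem displacement_apply (w : Fin 3 → ℝ) : displacement D w = !₂[w 0, w 1] - w 2 • D := rfl

theorem lineForm_apply (w : Fin 3 → ℝ) :
    lineForm D n κ w = ⟪n, displacement D w⟫ + κ * w 2 := rfl

theorem displacement_homog (X : Plane) : displacement D (homog X) = X - D := by
  ext i
  fin_cases i <;> simp [displacement_apply, homog]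

theorem lineForm_homog (X : Plane) : lineForm D n κ (homog X) = ⟪n, X - D⟫ + κ := by
  rw [lineForm_apply, displacement_homog]
  simp [homog]

theorem mem_polar_iff_lineForm_eq_zero {I : Sphere Plane} {P X : Plane} :
    X ∈ polar I P ↔ lineForm I.center (P - I.center) (-I.radius ^ 2) (homog X) = 0 := by
  rw [lineForm_homog, real_inner_comm, ← sub_eq_add_neg, sub_eq_zero]
  rfl

theorem exists_lineForm_homog_eq_zero (hn : n ≠ 0) : ∃ X, lineForm D n κ (homog X) = 0 := by
  refine ⟨D - (κ / ‖n‖ ^ 2) • n, ?_⟩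
  have hn' : ‖n‖ ≠ 0 := norm_ne_zero_iff.2 hn
  rw [lineForm_homog, sub_sub_cancel_left, inner_neg_right, inner_smul_right,
    real_inner_self_eq_norm_sq]
  field_simp
  ring

theorem exists_displacement_lineForm_eq (hκ : κ ≠ 0) (q : Plane) (s : ℝ) :
    ∃ v, displacement D v = q ∧ lineForm D n κ v = s := by
  obtain ⟨z, hz⟩ : ∃ z, κ * z = s - ⟪n, q⟫ := ⟨_, mul_div_cancel₀ _ hκ⟩
  have hq : displacement D ![q 0 + z * D 0, q 1 + z * D 1, z] = q := by
    ext i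
    fin_cases i <;> simp [displacement_apply]
  refine ⟨_, hq, ?_⟩
  rw [lineForm_apply, hq]
  change ⟪n, q⟫ + κ * z = s
  rw [hz, add_sub_cancel]

end LineForm

theorem projClosure_eq_ker {L : AffineSubspace ℝ Plane} {φ : (Fin 3 → ℝ) →ₗ[ℝ] ℝ}
    (hne : (L : Set Plane).Nonempty) (hL : ∀ X, X ∈ L ↔ φ (homog X) = 0) :
    projClosure L = LinearMap.ker φ := by
  refine le_antisymm (Submodule.span_le.2 ?_) fun w hw => ?_
  · rintro _ ⟨X, hX, rfl⟩
    exact (hL X).1 hX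
  · obtain ⟨X, hX⟩ := hne
    obtain ⟨Y, hY⟩ : ∃ Y, homog Y = w - (w 2 - 1) • homog X := by
      refine ⟨!₂[w 0 - (w 2 - 1) * X 0, w 1 - (w 2 - 1) * X 1], ?_⟩
      ext i
      fin_cases i <;> simp [homog]
    have hYL : Y ∈ L := by
      rw [hL, hY, map_sub, map_smul, (hL X).1 hX, LinearMap.mem_ker.1 hw, smul_zero, sub_zero]
    rw [← sub_add_cancel w ((w 2 - 1) • homog X), ← hY]
    exact add_mem (Submodule.subset_span ⟨Y, hYL, rfl⟩)
      (Submodule.smul_mem _ _ (Submodule.subset_span ⟨X, hX, rfl⟩))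

theorem homog_dotProduct_mulVec {M : Matrix (Fin 3) (Fin 3) ℝ} (hM : M.IsSymm) (X : Plane) :
    homog X ⬝ᵥ (M *ᵥ homog X) = M 0 0 * X 0 ^ 2 + M 1 1 * X 1 ^ 2 + M 2 2
      + 2 * (M 0 1 * (X 0 * X 1) + M 0 2 * X 0 + M 1 2 * X 1) := by
  simp only [homog, dotProduct, mulVec, Fin.sum_univ_three, cons_val, hM.apply 0 1, hM.apply 0 2,
    hM.apply 1 2]
  ring

theorem eq_of_homog_dotProduct_mulVec {M N : Matrix (Fin 3) (Fin 3) ℝ} (hM : M.IsSymm)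
    (hN : N.IsSymm)
    (h : ∀ X : Plane, homog X ⬝ᵥ (M *ᵥ homog X) = homog X ⬝ᵥ (N *ᵥ homog X)) : M = N := by
  simp only [homog_dotProduct_mulVec hM, homog_dotProduct_mulVec hN] at h
  have h0 := h !₂[0, 0]
  have hx := h !₂[1, 0]
  have hx' := h !₂[-1, 0]
  have hy := h !₂[0, 1]
  have hy' := h !₂[0, -1]
  have hxy := h !₂[1, 1]
  simp only [cons_val] at h0 hx hx' hy hy' hxy
  have h01 : M 0 1 = N 0 1 := by linarith
  have h02 : M 0 2 = N 0 2 := by linarith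
  have h12 : M 1 2 = N 1 2 := by linarith
  ext i j
  fin_cases i <;> fin_cases j <;> simp only [Fin.zero_eta, Fin.mk_one, Fin.reduceFinMk] <;>
    linarith [h01, h02, h12, hM.apply 0 1, hM.apply 0 2, hM.apply 1 2, hN.apply 0 1, hN.apply 0 2,
      hN.apply 1 2]

namespace Conic

variable {γ δ : Conic} {L : AffineSubspace ℝ Plane}

theorem isTangent_iff_of_mem_projClosure_iff {v : Fin 3 → ℝ} (hv : v ≠ 0)
    (hL : ∀ w, w ∈ projClosure L ↔ v ⬝ᵥ (γ.M *ᵥ w) = 0) :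
    γ.IsTangent L ↔ v ⬝ᵥ (γ.M *ᵥ v) = 0 := by
  refine ⟨?_, fun h => ⟨v, hv, h, hL⟩⟩
  rintro ⟨u, -, huu, hu⟩
  have huv : ∀ w, u ⬝ᵥ (γ.M *ᵥ w) = 0 → v ⬝ᵥ (γ.M *ᵥ w) = 0 :=
    fun w h => (hL w).1 ((hu w).2 h)
  refine huv v ?_
  rw [← γ.symm.eq, dotProduct_transpose_mulVec]
  exact huv u huu

theorem isTangent_iff_of_eq_smul {c : ℝ} (hc : c ≠ 0) (h : γ.M = c • δ.M) :
    γ.IsTangent L ↔ δ.IsTangent L := by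
  simp only [IsTangent, h, smul_mulVec, dotProduct_smul, smul_eq_zero, hc, false_or]

end Conic

section FocalConic

/-- The matrix of the coordinates `(X - D, ⟪n, X - D⟫ + κ)`, in which the conic
`‖X - D‖² = (⟪n, X - D⟫ + κ)²` becomes the cone `x² + y² = s²`. -/
def focalFrame (D n : Plane) (κ : ℝ) : Matrix (Fin 3) (Fin 3) ℝ :=
  !![1, 0, -D 0; 0, 1, -D 1; n 0, n 1, κ - n 0 * D 0 - n 1 * D 1]

/-- The matrix of the quadratic form `‖X - D‖² - (⟪n, X - D⟫ + κ)²`. -/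
def focalMatrix (D n : Plane) (κ : ℝ) : Matrix (Fin 3) (Fin 3) ℝ :=
  (focalFrame D n κ)ᵀ * diagonal ![1, 1, -1] * focalFrame D n κ

variable {D n : Plane} {κ : ℝ}

theorem focalFrame_mulVec (w : Fin 3 → ℝ) :
    focalFrame D n κ *ᵥ w = ![displacement D w 0, displacement D w 1, lineForm D n κ w] := by
  ext i
  fin_cases i <;>
    simp only [focalFrame, mulVec, dotProduct, Fin.sum_univ_three, displacement_apply,
      lineForm_apply, inner_plane, Fin.zero_eta, Fin.mk_one, Fin.reduceFinMk, of_apply, cons_val,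
      PiLp.sub_apply, PiLp.smul_apply, smul_eq_mul] <;> ring

theorem dotProduct_focalMatrix_mulVec (v w : Fin 3 → ℝ) :
    v ⬝ᵥ (focalMatrix D n κ *ᵥ w) =
      ⟪displacement D v, displacement D w⟫ - lineForm D n κ v * lineForm D n κ w := by
  rw [focalMatrix, ← mulVec_mulVec, ← mulVec_mulVec, dotProduct_transpose_mulVec, dotProduct_comm,
    focalFrame_mulVec, focalFrame_mulVec]
  simp only [mulVec_diagonal, dotProduct, Fin.sum_univ_three, inner_plane, cons_val]
  ring

theorem homog_dotProduct_focalMatrix_mulVec (X : Plane) :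
    homog X ⬝ᵥ (focalMatrix D n κ *ᵥ homog X) = dist X D ^ 2 - (⟪n, X - D⟫ + κ) ^ 2 := by
  rw [dotProduct_focalMatrix_mulVec, displacement_homog, lineForm_homog,
    real_inner_self_eq_norm_sq, dist_eq_norm, ← sq]

theorem focalMatrix_isSymm : (focalMatrix D n κ).IsSymm := by
  simp only [IsSymm, focalMatrix, transpose_mul, transpose_transpose, diagonal_transpose,
    Matrix.mul_assoc]

theorem det_focalMatrix : (focalMatrix D n κ).det = -κ ^ 2 := by
  have hframe : (focalFrame D n κ).det = κ := by
    simp only [focalFrame, det_fin_three, of_apply, cons_val]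
    ring
  rw [focalMatrix, det_mul, det_mul, det_transpose, hframe, det_diagonal, Fin.prod_univ_three]
  simp only [cons_val]
  ring

/-- The conic `‖X - D‖² = (⟪n, X - D⟫ + κ)²`. It has focus `D` and eccentricity `‖n‖`, and `κ ≠ 0`
says that `D` is not on the directrix. -/
noncomputable def focalConic (D n : Plane) (κ : ℝ) (hκ : κ ≠ 0) : Conic where
  M := focalMatrix D n κ
  symm := focalMatrix_isSymm
  nondegenerate := det_focalMatrix.trans_ne (neg_ne_zero.2 (pow_ne_zero 2 hκ))
  real_point := by
    obtain ⟨v, hq, hs⟩ :=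
      exists_displacement_lineForm_eq (D := D) (n := n) hκ (EuclideanSpace.single 0 1) 1
    refine ⟨v, ?_, by simp [dotProduct_focalMatrix_mulVec, hq, hs]⟩
    rintro rfl
    simp at hs

theorem focalConic_isFocus (hκ : κ ≠ 0) : (focalConic D n κ hκ).IsFocus D := by
  refine ⟨1, n 0, n 1, κ - ⟪n, D⟫, one_ne_zero, fun X => ?_⟩
  rw [one_mul]
  refine (homog_dotProduct_focalMatrix_mulVec X).trans ?_
  simp only [inner_sub_right, inner_plane]
  ring

theorem Conic.IsFocus.exists_eq_smul_focalConic {γ : Conic} (h : γ.IsFocus D) :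
    ∃ (c : ℝ) (n : Plane) (κ : ℝ) (hκ : κ ≠ 0), c ≠ 0 ∧ γ.M = c • (focalConic D n κ hκ).M := by
  obtain ⟨c, a, b, k, hc, hγ⟩ := h
  have hM : γ.M = c • focalMatrix D !₂[a, b] (a * D 0 + b * D 1 + k) := by
    refine eq_of_homog_dotProduct_mulVec γ.symm (focalMatrix_isSymm.smul c) fun X => ?_
    have hline : ⟪!₂[a, b], X - D⟫ + (a * D 0 + b * D 1 + k) = a * X 0 + b * X 1 + k := by
      simp only [inner_plane, PiLp.sub_apply, cons_val]
      ring
    rw [hγ, smul_mulVec, dotProduct_smul, homog_dotProduct_focalMatrix_mulVec, hline, smul_eq_mul]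
  refine ⟨c, !₂[a, b], a * D 0 + b * D 1 + k, fun hκ => γ.nondegenerate ?_, hc, hM⟩
  simp [hM, det_focalMatrix, hκ]

theorem focalConic_isTangent_iff (hκ : κ ≠ 0) {L : AffineSubspace ℝ Plane} {m : Plane} {μ : ℝ}
    (hm : m ≠ 0) (hL : ∀ X, X ∈ L ↔ lineForm D m μ (homog X) = 0) :
    (focalConic D n κ hκ).IsTangent L ↔ ‖κ • m - μ • n‖ = |μ| := by
  obtain ⟨v, hq, hs⟩ := exists_displacement_lineForm_eq (D := D) (n := n) hκ (κ • m - μ • n) (-μ)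
  have hv0 : v ≠ 0 := by
    rintro rfl
    obtain rfl : μ = 0 := by simpa using hs.symm
    exact smul_ne_zero hκ hm (by simpa using hq.symm)
  have hpolar : ∀ w, v ⬝ᵥ (focalMatrix D n κ *ᵥ w) = κ * lineForm D m μ w := by
    intro w
    simp only [dotProduct_focalMatrix_mulVec, hq, hs, lineForm_apply, inner_sub_left,
      real_inner_smul_left]
    ring
  have hclosure : ∀ w, w ∈ projClosure L ↔ v ⬝ᵥ (focalMatrix D n κ *ᵥ w) = 0 := by
    obtain ⟨X, hX⟩ := exists_lineForm_homog_eq_zero (D := D) (κ := μ) hm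
    intro w
    rw [projClosure_eq_ker ⟨X, (hL X).2 hX⟩ hL, LinearMap.mem_ker, hpolar, mul_eq_zero,
      or_iff_right hκ]
  refine (Conic.isTangent_iff_of_mem_projClosure_iff hv0 hclosure).trans ?_
  change v ⬝ᵥ (focalMatrix D n κ *ᵥ v) = 0 ↔ _
  rw [dotProduct_focalMatrix_mulVec, hq, hs, real_inner_self_eq_norm_sq, sub_eq_zero, neg_mul_neg,
    ← sq, sq_eq_sq_iff_abs_eq_abs, abs_norm]

end FocalConic

section Reciprocation

/-- The conic `γ` is the polar reciprocal of the circle `S` with respect to `I`: its tangents are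
the polars of the points of `S`. The centre of `I` is excluded, since its polar is not a line. -/
def IsPolarReciprocal (I : Sphere Plane) (γ : Conic) (S : Sphere Plane) : Prop :=
  ∀ P, P ≠ I.center → (γ.IsTangent (polar I P) ↔ P ∈ S)

/-- The polar reciprocal with respect to `I` of the conic `‖X - D‖² = (⟪n, X - D⟫ + κ)²`, where `D`
is the centre of `I` and `κ ≠ 0`. -/
noncomputable def reciprocalCircle (I : Sphere Plane) (n : Plane) (κ : ℝ) : Sphere Plane where
  center := I.center - (I.radius ^ 2 / κ) • n
  radius := I.radius ^ 2 / |κ|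

variable {I : Sphere Plane}

theorem mem_reciprocalCircle_iff {n P : Plane} {κ : ℝ} (hκ : κ ≠ 0) :
    P ∈ reciprocalCircle I n κ ↔
      ‖κ • (P - I.center) + I.radius ^ 2 • n‖ = I.radius ^ 2 := by
  have hvec : κ • (P - I.center) + I.radius ^ 2 • n
      = κ • (P - (I.center - (I.radius ^ 2 / κ) • n)) := by
    rw [sub_sub_eq_add_sub, add_sub_right_comm, smul_add, smul_smul, mul_div_cancel₀ _ hκ]
  rw [hvec, norm_smul, Real.norm_eq_abs, mul_comm, ← eq_div_iff (abs_ne_zero.2 hκ),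
    ← dist_eq_norm]
  rfl

theorem isPolarReciprocal_focalConic {n : Plane} {κ : ℝ} (hκ : κ ≠ 0) :
    IsPolarReciprocal I (focalConic I.center n κ hκ) (reciprocalCircle I n κ) := by
  intro P hP
  rw [mem_reciprocalCircle_iff hκ, focalConic_isTangent_iff hκ (sub_ne_zero.2 hP)
    fun X => mem_polar_iff_lineForm_eq_zero, abs_neg, abs_sq, neg_smul, sub_neg_eq_add]

theorem exists_reciprocalCircle_eq (hI : I.radius ≠ 0) {S : Sphere Plane} (hS : 0 < S.radius) :
    ∃ (n : Plane) (κ : ℝ), κ ≠ 0 ∧ reciprocalCircle I n κ = S := by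
  have hκ : 0 < I.radius ^ 2 / S.radius := by positivity
  have hratio : I.radius ^ 2 / (I.radius ^ 2 / S.radius) = S.radius :=
    div_div_cancel₀ (pow_ne_zero 2 hI)
  refine ⟨S.radius⁻¹ • (I.center - S.center), _, hκ.ne', Sphere.ext ?_ ?_⟩
  · rw [reciprocalCircle, hratio, smul_inv_smul₀ hS.ne', sub_sub_cancel]
  · rw [reciprocalCircle, abs_of_pos hκ, hratio]

theorem exists_isFocus_isPolarReciprocal (hI : I.radius ≠ 0) {S : Sphere Plane}
    (hS : 0 < S.radius) : ∃ γ : Conic, γ.IsFocus I.center ∧ IsPolarReciprocal I γ S := by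
  obtain ⟨n, κ, hκ, rfl⟩ := exists_reciprocalCircle_eq hI hS
  exact ⟨_, focalConic_isFocus hκ, isPolarReciprocal_focalConic hκ⟩

theorem Conic.IsFocus.exists_isPolarReciprocal (hI : I.radius ≠ 0) {γ : Conic}
    (hγ : γ.IsFocus I.center) :
    ∃ S : Sphere Plane, 0 < S.radius ∧ IsPolarReciprocal I γ S := by
  obtain ⟨c, n, κ, hκ, hc, hM⟩ := hγ.exists_eq_smul_focalConic
  refine ⟨reciprocalCircle I n κ, div_pos (by positivity) (abs_pos.2 hκ), fun P hP => ?_⟩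
  rw [Conic.isTangent_iff_of_eq_smul hc hM, isPolarReciprocal_focalConic hκ P hP]

theorem IsPolarReciprocal.poles_mem_iff_isTangent_sides {γ : Conic} {S : Sphere Plane}
    (h : IsPolarReciprocal I γ S) (hI : 0 < I.radius) {T : Affine.Triangle ℝ Plane}
    (hT : ∀ i, I.center ∉ sideLine T.points i) :
    (∀ i, pole I (sideLine T.points i) ∈ S) ↔ ∀ i, γ.IsTangent (sideLine T.points i) :=
  forall_congr' fun i => by
    rw [← polar_polarTriangle hI (hT i), h _ (polarTriangle_ne_center hI (hT i)),
      polar_polarTriangle hI (hT i), polarTriangle]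

theorem IsPolarReciprocal.isTangent_sides_polarTriangle {γ : Conic} {C : Sphere Plane}
    (h : IsPolarReciprocal I γ C) (hI : 0 < I.radius) {T : Affine.Triangle ℝ Plane}
    (hT : InscribedAvoiding C I.center T) (i : Fin 3) :
    γ.IsTangent (sideLine (polarTriangle I T.points) i) := by
  have hvertex : T.points i ≠ I.center := fun hi =>
    hT.2 (i + 1) (hi ▸ points_mem_sideLine_iff.2 (add_ne_left.2 (by decide)).symm)
  rw [sideLine_polarTriangle hI hT.2, h _ hvertex]
  exact hT.1 i

end Reciprocation

theorem mainTheorem7_general (I : Sphere Plane) (hI : 0 < I.radius) :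
    (∀ S : Set (Affine.Triangle ℝ Plane),
      (∀ T ∈ S, ∀ i, I.center ∉ sideLine T.points i) →
      ((∃ Cp : Sphere Plane, 0 < Cp.radius ∧
          ∀ T ∈ S, ∀ i, pole I (sideLine T.points i) ∈ Cp) ↔
        ∃ γ : Conic, γ.IsFocus I.center ∧ ∀ T ∈ S, ∀ i, γ.IsTangent (sideLine T.points i))) ∧
    (∀ Cp : Sphere Plane, 0 < Cp.radius → ∃ γ : Conic, γ.IsFocus I.center ∧
      ∀ T : Affine.Triangle ℝ Plane, (∀ i, I.center ∉ sideLine T.points i) →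
        ((∀ i, pole I (sideLine T.points i) ∈ Cp) ↔ ∀ i, γ.IsTangent (sideLine T.points i))) ∧
    (∀ γ : Conic, γ.IsFocus I.center → ∃ Cp : Sphere Plane, 0 < Cp.radius ∧
      ∀ T : Affine.Triangle ℝ Plane, (∀ i, I.center ∉ sideLine T.points i) →
        ((∀ i, pole I (sideLine T.points i) ∈ Cp) ↔ ∀ i, γ.IsTangent (sideLine T.points i))) ∧
    (∀ C : Sphere Plane, 0 < C.radius → ∃ Γ : Conic, Γ.IsFocus I.center ∧
      ∀ T : Affine.Triangle ℝ Plane, InscribedAvoiding C I.center T →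
        ∀ i, Γ.IsTangent (sideLine (polarTriangle I T.points) i)) := by
  refine ⟨fun S hS => ⟨?_, ?_⟩, fun Cp hCp => ?_, fun γ hγ => ?_, fun C hC => ?_⟩
  · rintro ⟨Cp, hCp, hpoles⟩
    obtain ⟨γ, hγ, h⟩ := exists_isFocus_isPolarReciprocal hI.ne' hCp
    exact ⟨γ, hγ, fun T hT => (h.poles_mem_iff_isTangent_sides hI (hS T hT)).1 (hpoles T hT)⟩
  · rintro ⟨γ, hγ, hsides⟩
    obtain ⟨Cp, hCp, h⟩ := hγ.exists_isPolarReciprocal hI.ne'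
    exact ⟨Cp, hCp, fun T hT => (h.poles_mem_iff_isTangent_sides hI (hS T hT)).2 (hsides T hT)⟩
  · obtain ⟨γ, hγ, h⟩ := exists_isFocus_isPolarReciprocal hI.ne' hCp
    exact ⟨γ, hγ, fun T => h.poles_mem_iff_isTangent_sides hI⟩
  · obtain ⟨Cp, hCp, h⟩ := hγ.exists_isPolarReciprocal hI.ne'
    exact ⟨Cp, hCp, fun T => h.poles_mem_iff_isTangent_sides hI⟩
  · obtain ⟨Γ, hΓ, h⟩ := exists_isFocus_isPolarReciprocal hI.ne' hC
    exact ⟨Γ, hΓ, fun T => h.isTangent_sides_polarTriangle hI⟩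

theorem mainTheorem7 (C I : Sphere Plane) (hC : 0 < C.radius) (hI : 0 < I.radius)
    (hD : I.center ∉ C) :
    -- for every family `S` of triangles inscribed in `C`
    (∀ S : Set (Affine.Triangle ℝ Plane), (∀ T ∈ S, InscribedAvoiding C I.center T) →
      ((∃ Cp : Sphere Plane, 0 < Cp.radius ∧
          ∀ T ∈ S, ∀ i, pole I (sideLine T.points i) ∈ Cp) ↔
        ∃ γ : Conic, γ.IsFocus I.center ∧ ∀ T ∈ S, ∀ i, γ.IsTangent (sideLine T.points i))) ∧
    -- a given circle `Cp` has such a conic `γ` for all triangles at once, and vice versa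
    (∀ Cp : Sphere Plane, 0 < Cp.radius → ∃ γ : Conic, γ.IsFocus I.center ∧
      ∀ T : Affine.Triangle ℝ Plane, InscribedAvoiding C I.center T →
        ((∀ i, pole I (sideLine T.points i) ∈ Cp) ↔ ∀ i, γ.IsTangent (sideLine T.points i))) ∧
    (∀ γ : Conic, γ.IsFocus I.center → ∃ Cp : Sphere Plane, 0 < Cp.radius ∧
      ∀ T : Affine.Triangle ℝ Plane, InscribedAvoiding C I.center T →
        ((∀ i, pole I (sideLine T.points i) ∈ Cp) ↔ ∀ i, γ.IsTangent (sideLine T.points i))) ∧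
    -- the sides of the polar triangles are tangent to a fixed conic, independent of the family
    (∃ Γ : Conic, Γ.IsFocus I.center ∧
      ∀ S : Set (Affine.Triangle ℝ Plane), (∀ T ∈ S, InscribedAvoiding C I.center T) →
        (∃ Cp : Sphere Plane, 0 < Cp.radius ∧
          ∀ T ∈ S, ∀ i, pole I (sideLine T.points i) ∈ Cp) →
        ∀ T ∈ S, ∀ i, Γ.IsTangent (sideLine (polarTriangle I T.points) i)) := by
  obtain ⟨hfamily, hconic, hcircle, hpolar⟩ := mainTheorem7_general I hI
  refine ⟨fun S hS => hfamily S fun T hT => (hS T hT).2, fun Cp hCp => ?_, fun γ hγ => ?_, ?_⟩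
  · exact (hconic Cp hCp).imp fun γ h => ⟨h.1, fun T hT => h.2 T hT.2⟩
  · exact (hcircle γ hγ).imp fun Cp h => ⟨h.1, fun T hT => h.2 T hT.2⟩
  · exact (hpolar C hC).imp fun Γ h => ⟨h.1, fun S hS _ T hT => h.2 T (hS T hT)⟩
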